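/- Let $P\in\mathbb F_2[x]$ be an irreducible polynomial of degree $m$, and write the elements of $\mathrm{GF}(2^m)=\mathbb F_2[x]/(P)$ in the basis $1,x,\dots,x^{m-1}$. An ancilla-free multiplier for $P$ is a reversible circuit of CNOT and Toffoli gates acting on exactly $3m$ wires that maps $|a,b,0\rangle\mapsto|a,b,ab\rangle$ for all $a,b\in\mathrm{GF}(2^m)$. For an integer $K\ge 0$ call a polynomial $K$-suitable for $m$ if it has one of the following forms: 1. $x^m+x^l+1$ with $0<l<\lfloor m/2\rfloor$; 2. $x^m+x^{l_1}+\cdots+x^{l_k}+1$ with $m$ even, $k\ge1$, $m/2>l_1>\cdots>l_k>0$ and $l_1-l_k\le K$; 3. $x^m+x^{l_1}+\cdots+x^{l_k}+1$ with $k\ge1$, $\lfloor m/2\rfloor>l_1>\cdots>l_k>0$ and $l_1\le K\log_2 m$; 4. $x^m+(x^{n-1}+x^{n-2}+\cdots+x^{n-l_1})+(x^{l_2}+x^{l_2-1}+\cdots+1)$ with $m=2n+1$, $l_1,l_2\ge0$ and $n-l_1>l_2$. (a) For every $K$ there is a constant $C$ such that for every $m$ and every irreducible polynomial $P$ that is $K$-suitable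 for $m$, there is an ancilla-free multiplier for $P$ with at most $C\,m^{\log_2 3}$ gates (CNOT and Toffoli gates together). (b) Consequently, if for some $K$ there is an irreducible $K$-suitable polynomial for every sufficiently large $m$, then there is a constant $C$ such that for every $m\ge1$ there are an irreducible polynomial $P$ of degree $m$ and an ancilla-free multiplier for $P$ with at most $C\,m^{\log_2 3}$ gates. -/

import Mathlib

namespace GFMul

open Polynomial

/-- A reversible gate on wires `ι`: a CNOT (one control, one target) or a Toffoli gate
(two controls, one target).  The wires a gate acts on are distinct. -/
inductive Gate (ι : Type) : Type
  | cnot (control target : ι) (h : control ≠ target) : Gate ι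
  | toffoli (control₁ control₂ target : ι) (h₁₂ : control₁ ≠ control₂)
      (h₁ : control₁ ≠ target) (h₂ : control₂ ≠ target) : Gate ι

/-- Action of a gate on a computational basis state (an assignment of bits to the wires). -/
def Gate.act {ι : Type} [DecidableEq ι] : Gate ι → (ι → ZMod 2) → (ι → ZMod 2)
  | .cnot c t _, s => Function.update s t (s t + s c)
  | .toffoli c₁ c₂ t _ _ _, s => Function.update s t (s t + s c₁ * s c₂)

/-- A circuit is a finite sequence of gates, applied from left to right. -/
abbrev Circuit (ι : Type) : Type := List (Gate ι)

/-- Action of a circuit on a computational basis state. -/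
def Circuit.run {ι : Type} [DecidableEq ι] (c : Circuit ι) (s : ι → ZMod 2) : ι → ZMod 2 :=
  c.foldl (fun s g => g.act s) s

/-- The number of gates (CNOT and Toffoli gates together). -/
def Circuit.gateCount {ι : Type} (c : Circuit ι) : ℕ := c.length

/-- The `3m` wires of an ancilla-free multiplier: three registers of `m` wires each. -/
abbrev Wire (m : ℕ) : Type := Fin 3 × Fin m

/-- The basis state `|a, b, c⟩`. -/
def ket {m : ℕ} (a b c : Fin m → ZMod 2) : Wire m → ZMod 2 :=
  fun w => (![a, b, c] w.1) w.2

/-- The polynomial `a₀ + a₁ x + ⋯ + a_{m-1} x^{m-1}` that a register content stands for. -/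
noncomputable def toPoly {m : ℕ} (a : Fin m → ZMod 2) : (ZMod 2)[X] :=
  ∑ i : Fin m, C (a i) * X ^ (i : ℕ)

/-- The product of two elements of `GF(2^m) = 𝔽₂[x]/(P)`, `deg P = m`, in the basis
`1, x, …, x^{m-1}`: polynomial multiplication modulo `P`. -/
noncomputable def fieldMul {m : ℕ} (P : (ZMod 2)[X]) (a b : Fin m → ZMod 2) : Fin m → ZMod 2 :=
  fun i => ((toPoly a * toPoly b) %ₘ P).coeff i

/-- The circuit maps `|a, b, 0⟩` to `|a, b, ab⟩` for all field elements `a`, `b`, using no wires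
other than those of the three registers. -/
def ComputesMul {m : ℕ} (P : (ZMod 2)[X]) (c : Circuit (Wire m)) : Prop :=
  ∀ a b : Fin m → ZMod 2, c.run (ket a b 0) = ket a b (fieldMul P a b)

/-- The polynomial `x^m + ∑_{l ∈ L} x^l + 1`. -/
noncomputable def sparsePoly (m : ℕ) (L : Finset ℕ) : (ZMod 2)[X] :=
  X ^ m + ∑ l ∈ L, X ^ l + 1

/-- The polynomial `x^(2n+1) + (x^(n-1) + ⋯ + x^(n-l₁)) + (x^l₂ + ⋯ + x + 1)`. -/
noncomputable def runsPoly (n l₁ l₂ : ℕ) : (ZMod 2)[X] :=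
  X ^ (2 * n + 1) + ∑ i ∈ Finset.Ico (n - l₁) n, X ^ i + ∑ i ∈ Finset.range (l₂ + 1), X ^ i

/-- The shapes of degree-`m` polynomials used for multiplication by `1 + x^⌈m/2⌉`.  In all of
them the exponents strictly between `0` and `m` are smaller than `⌊m/2⌋`; the number `K` is the
constant hidden in the conditions `l₁ - l_k ∈ O(1)` and `l₁ ∈ O(log m)`. -/
inductive Suitable (K m : ℕ) : (ZMod 2)[X] → Prop
  /-- `x^m + x^l + 1`. -/
  | trinomial (l : ℕ) (h0 : 0 < l) (hl : l < m / 2) : Suitable K m (sparsePoly m {l})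
  /-- `m` even, `x^m + x^{l₁} + ⋯ + x^{l_k} + 1` with `l₁ - l_k ≤ K`. -/
  | clustered (hm : Even m) (L : Finset ℕ) (hne : L.Nonempty)
      (hL : ∀ l ∈ L, 0 < l ∧ l < m / 2) (hK : ∀ l ∈ L, ∀ l' ∈ L, l ≤ l' + K) :
      Suitable K m (sparsePoly m L)
  /-- `x^m + x^{l₁} + ⋯ + x^{l_k} + 1` with `l₁ ≤ K log₂ m`. -/
  | lowDegree (L : Finset ℕ) (hne : L.Nonempty)
      (hL : ∀ l ∈ L, 0 < l ∧ l < m / 2) (hK : ∀ l ∈ L, (l : ℝ) ≤ K * Real.logb 2 m) :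
      Suitable K m (sparsePoly m L)
  /-- `m = 2n + 1`, `x^m` plus two runs of consecutive monomials. -/
  | runs (n l₁ l₂ : ℕ) (hm : m = 2 * n + 1) (hl : l₁ + l₂ < n) : Suitable K m (runsPoly n l₁ l₂)

end GFMul

/-! Write P = X^m + Q and split the product ab = low + X^m * high, with low of degree < m. The
circuit first adds high to the zero register, then multiplies that register in place by X^m modulo
P, and finally adds low.

Both halves are truncated products. `low` is ab modulo X^m, and `high` is the truncated product of
the reversed inputs (`coeff_mul_of_reversed`), so reading the wires backwards suffices. A truncated
product (`implements_mulAdd_short`) reduces to one full and two truncated products of half size. The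
full one is Karatsuba's (`implements_mulAdd_full`), based over 𝔽₂ on fg = (1 + X^k)(f₀g₀ + X^k f₁g₁)
+ X^k (f₀ + f₁)(g₀ + g₁). No ancilla is needed, because adding (1 + X^k)p to h amounts to dividing h
by 1 + X^k, adding p and multiplying back. All of this is invertible modulo a power of X and linear
in cost.

Multiplication by X^m is done as X^⌈m/2⌉ followed by X^⌊m/2⌋. For j + l = m and deg Q ≤ l, write the
content as v + X^l u with deg v < l; then X^j (v + X^l u) ≡ X^j v + uQ. This is a rotation of the
wires, which is free, together with u ↦ uQ. The latter costs O(m) times the number of terms of (1 +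
X)Q (`implements_mul_low`). The two rotations together restore the original order.

For suitable P, (1 + X)Q has O(log m) terms, so reduction costs O(m log m), below m^{3/2} ≤ m^{log₂
3} up to a constant. For (b), the finitely many remaining degrees use any irreducible polynomial
with schoolbook multiplication, and their cost goes into the constant. -/

namespace GFMul

open Polynomial

/-! ### Register contents as polynomials over 𝔽₂ -/

section Registers

variable {ι : Type}

/-- The polynomial whose coefficients are the bits on the wires `r 0, …, r (n - 1)`. -/
noncomputable def readReg (r : ℕ → ι) (n : ℕ) : (ι → ZMod 2) →ₗ[ZMod 2] (ZMod 2)[X] :=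
  ∑ i ∈ Finset.range n, (Polynomial.monomial i).comp (LinearMap.proj (r i))

/-- The wires `r 0, …, r (n - 1)` are distinct. -/
def Distinct (r : ℕ → ι) (n : ℕ) : Prop := ∀ i < n, ∀ j < n, r i = r j → i = j

/-- The wires `r 0, …, r (n - 1)` are different from the wires `r' 0, …, r' (m - 1)`. -/
def Apart (r : ℕ → ι) (n : ℕ) (r' : ℕ → ι) (m : ℕ) : Prop := ∀ i < n, ∀ j < m, r i ≠ r' j

lemma Distinct.shift {r : ℕ → ι} {n a k : ℕ} (h : Distinct r n) (hk : a + k ≤ n) :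
    Distinct (fun i => r (a + i)) k := fun i hi j hj e => by
  have := h (a + i) (by omega) (a + j) (by omega) e
  omega

lemma Distinct.mono {r : ℕ → ι} {n k : ℕ} (h : Distinct r n) (hk : k ≤ n) : Distinct r k :=
  fun i hi j hj e => h i (by omega) j (by omega) e

lemma Apart.symm {r r' : ℕ → ι} {n m : ℕ} (h : Apart r n r' m) : Apart r' m r n :=
  fun i hi j hj e => h j hj i hi e.symm

lemma Apart.mono {r r' : ℕ → ι} {n m n' m' : ℕ} (h : Apart r n r' m) (hn : n' ≤ n)
    (hm : m' ≤ m) : Apart r n' r' m' := fun i hi j hj => h i (by omega) j (by omega)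

lemma Apart.shift_left {r r' : ℕ → ι} {n m n' a : ℕ} (h : Apart r n r' m) (hn : a + n' ≤ n) :
    Apart (fun i => r (a + i)) n' r' m := fun i hi j hj => h (a + i) (by omega) j hj

lemma Apart.shift_right {r r' : ℕ → ι} {n m m' a : ℕ} (h : Apart r n r' m) (hm : a + m' ≤ m) :
    Apart r n (fun i => r' (a + i)) m' := fun i hi j hj => h i hi (a + j) (by omega)

lemma Distinct.apart_shift {r : ℕ → ι} {n a k : ℕ} (h : Distinct r n) (hk : a + k ≤ n) :
    Apart r a (fun i => r (a + i)) k := fun i hi j hj e => by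
  have := h i (by omega) (a + j) (by omega) e
  omega

lemma coeff_readReg (r : ℕ → ι) (n : ℕ) (s : ι → ZMod 2) (i : ℕ) :
    (readReg r n s).coeff i = if i < n then s (r i) else 0 := by
  simp [readReg, LinearMap.sum_apply, Polynomial.coeff_monomial]

lemma degree_readReg_lt (r : ℕ → ι) (n : ℕ) (s : ι → ZMod 2) : (readReg r n s).degree < n := by
  rw [Polynomial.degree_lt_iff_coeff_zero]
  intro i hi
  rw [coeff_readReg, if_neg (by omega)]

lemma readReg_eq_sum (r : ℕ → ι) (n : ℕ) (s : ι → ZMod 2) :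
    readReg r n s = ∑ i ∈ Finset.range n, Polynomial.monomial i (s (r i)) := by
  simp [readReg, LinearMap.sum_apply]

lemma readReg_congr (r : ℕ → ι) {n : ℕ} {s t : ι → ZMod 2} (h : ∀ i < n, s (r i) = t (r i)) :
    readReg r n s = readReg r n t := by
  ext i
  rw [coeff_readReg, coeff_readReg]
  split_ifs with hi
  · exact h i hi
  · rfl

lemma readReg_add_eq (r : ℕ → ι) (a b : ℕ) (s : ι → ZMod 2) :
    readReg r (a + b) s = readReg r a s + X ^ a * readReg (fun i => r (a + i)) b s := by
  rw [readReg_eq_sum, readReg_eq_sum, readReg_eq_sum, Finset.sum_range_add, Finset.mul_sum]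
  congr 1
  refine Finset.sum_congr rfl fun i _ => ?_
  rw [← Polynomial.monomial_one_right_eq_X_pow, Polynomial.monomial_mul_monomial, one_mul]

lemma two_eq_zero_poly : (2 : (ZMod 2)[X]) = 0 := CharTwo.two_eq_zero

lemma coeff_mul_eq_sum_support (Q p : (ZMod 2)[X]) (n : ℕ) :
    (Q * p).coeff n = ∑ j ∈ Q.support, if j ≤ n then p.coeff (n - j) else 0 := by
  conv_lhs => rw [Q.as_sum_support_C_mul_X_pow, Finset.sum_mul, Polynomial.finsetSum_coeff]
  refine Finset.sum_congr rfl fun j hj => ?_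
  have h1 : Q.coeff j = 1 := by
    have h0 := Polynomial.mem_support_iff.1 hj
    generalize Q.coeff j = x at h0
    revert x
    decide
  rw [h1, map_one, one_mul, Polynomial.coeff_X_pow_mul']

end Registers

/-! ### Circuits as maps on states, and in-place linear operations -/

section Circuits

variable {ι : Type} [DecidableEq ι]

/-- The state carrying the first `n` coefficients of a polynomial on the wires
`r 0, …, r (n - 1)` and zeros elsewhere. -/
noncomputable def writeReg (r : ℕ → ι) (n : ℕ) : (ZMod 2)[X] →ₗ[ZMod 2] (ι → ZMod 2) :=
  ∑ i ∈ Finset.range n, (LinearMap.single (ZMod 2) (fun _ : ι => ZMod 2) (r i)).comp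
    (Polynomial.lcoeff (ZMod 2) i)

lemma writeReg_apply {r : ℕ → ι} {n : ℕ} (h : Distinct r n) (p : (ZMod 2)[X]) {i : ℕ}
    (hi : i < n) : writeReg r n p (r i) = p.coeff i := by
  simp only [writeReg, LinearMap.sum_apply, LinearMap.comp_apply, Finset.sum_apply,
    Polynomial.lcoeff_apply, LinearMap.single_apply]
  rw [Finset.sum_eq_single i]
  · simp
  · intro j hj hji
    rw [Pi.single_eq_of_ne]
    intro e
    exact hji (h i hi j (Finset.mem_range.1 hj) e).symm
  · intro h'
    exact absurd (Finset.mem_range.2 hi) h'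

lemma writeReg_apply_of_ne {r : ℕ → ι} {n : ℕ} (p : (ZMod 2)[X]) {w : ι}
    (hw : ∀ i < n, r i ≠ w) : writeReg r n p w = 0 := by
  simp only [writeReg, LinearMap.sum_apply, LinearMap.comp_apply, Finset.sum_apply,
    Polynomial.lcoeff_apply, LinearMap.single_apply]
  refine Finset.sum_eq_zero fun j hj => ?_
  rw [Pi.single_eq_of_ne]
  exact (hw j (Finset.mem_range.1 hj)).symm

lemma writeReg_eq_sum (r : ℕ → ι) (n : ℕ) (p : (ZMod 2)[X]) :
    writeReg r n p = ∑ i ∈ Finset.range n, Pi.single (r i) (p.coeff i) := by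
  simp [writeReg, LinearMap.sum_apply]

lemma writeReg_congr (r : ℕ → ι) {n : ℕ} {p q : (ZMod 2)[X]}
    (h : ∀ i < n, p.coeff i = q.coeff i) : writeReg r n p = writeReg r n q := by
  rw [writeReg_eq_sum, writeReg_eq_sum]
  exact Finset.sum_congr rfl fun i hi => by rw [h i (Finset.mem_range.1 hi)]

lemma writeReg_shift (r : ℕ → ι) (a n : ℕ) (p : (ZMod 2)[X]) :
    writeReg (fun i => r (a + i)) n p = writeReg r (a + n) (X ^ a * p) := by
  rw [writeReg_eq_sum, writeReg_eq_sum, Finset.sum_range_add,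
    Finset.sum_eq_zero (s := Finset.range a), zero_add]
  · exact Finset.sum_congr rfl fun i _ => by rw [add_comm a i, Polynomial.coeff_X_pow_mul]
  · intro i hi
    rw [Polynomial.coeff_X_pow_mul', if_neg (by simpa using hi), Pi.single_zero]

lemma writeReg_extend (r : ℕ → ι) {n m : ℕ} (hnm : n ≤ m) {p : (ZMod 2)[X]}
    (hp : p.degree < n) : writeReg r n p = writeReg r m p := by
  obtain ⟨k, rfl⟩ := Nat.exists_eq_add_of_le hnm
  rw [writeReg_eq_sum, writeReg_eq_sum, Finset.sum_range_add]
  rw [Finset.sum_eq_zero (s := Finset.range k), add_zero]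
  intro i _
  rw [Polynomial.coeff_eq_zero_of_degree_lt, Pi.single_zero]
  exact hp.trans_le (by exact_mod_cast Nat.le_add_right n i)

lemma readReg_writeReg {r : ℕ → ι} {n : ℕ} (h : Distinct r n) {p : (ZMod 2)[X]}
    (hp : p.degree < n) : readReg r n (writeReg r n p) = p := by
  ext i
  rw [coeff_readReg]
  split_ifs with hi
  · rw [writeReg_apply h p hi]
  · rw [Polynomial.coeff_eq_zero_of_degree_lt]
    exact hp.trans_le (by exact_mod_cast not_lt.1 hi)

lemma readReg_writeReg_of_apart {r r' : ℕ → ι} {n m : ℕ} (h : Apart r n r' m)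
    (p : (ZMod 2)[X]) : readReg r n (writeReg r' m p) = 0 := by
  rw [readReg_congr r (t := 0), map_zero]
  intro i hi
  exact writeReg_apply_of_ne p fun j hj e => h i hi j hj e.symm

/-- Some circuit with at most `N` gates acts on basis states as `F`. -/
def Implements (N : ℕ) (F : (ι → ZMod 2) → (ι → ZMod 2)) : Prop :=
  ∃ c : Circuit ι, c.length ≤ N ∧ ∀ s, c.run s = F s

lemma Implements.id : Implements 0 (fun s : ι → ZMod 2 => s) := ⟨[], le_rfl, fun _ => rfl⟩

lemma Implements.comp {N M : ℕ} {F G : (ι → ZMod 2) → (ι → ZMod 2)} (hG : Implements M G)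
    (hF : Implements N F) : Implements (N + M) (fun s => G (F s)) := by
  obtain ⟨c, hc, hc'⟩ := hF
  obtain ⟨d, hd, hd'⟩ := hG
  refine ⟨c ++ d, by simp; omega, fun s => ?_⟩
  simp only [← hc', ← hd', Circuit.run, List.foldl_append]

lemma Implements.mono {N M : ℕ} {F : (ι → ZMod 2) → (ι → ZMod 2)} (hF : Implements N F)
    (h : N ≤ M) : Implements M F := by
  obtain ⟨c, hc, hc'⟩ := hF
  exact ⟨c, hc.trans h, hc'⟩

lemma Implements.congr {N : ℕ} {F G : (ι → ZMod 2) → (ι → ZMod 2)} (hF : Implements N F)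
    (h : ∀ s, F s = G s) : Implements N G := by
  obtain ⟨c, hc, hc'⟩ := hF
  exact ⟨c, hc, fun s => (hc' s).trans (h s)⟩

lemma Gate.act_act (g : Gate ι) (s : ι → ZMod 2) : g.act (g.act s) = s := by
  cases g with
  | cnot a t h =>
    ext w
    by_cases hw : w = t
    · subst hw
      simp [Gate.act, h, add_assoc, CharTwo.add_self_eq_zero]
    · simp [Gate.act, hw]
  | toffoli a b t _ ha hb =>
    ext w
    by_cases hw : w = t
    · subst hw
      simp [Gate.act, ha, hb, add_assoc, CharTwo.add_self_eq_zero]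
    · simp [Gate.act, hw]

lemma Circuit.run_reverse_run (c : Circuit ι) (s : ι → ZMod 2) :
    Circuit.run c.reverse (Circuit.run c s) = s := by
  induction c generalizing s with
  | nil => rfl
  | cons g c ih =>
    have h1 : Circuit.run (g :: c) s = Circuit.run c (g.act s) := rfl
    rw [h1]
    have h2 : ∀ t, Circuit.run (g :: c).reverse t = g.act (Circuit.run c.reverse t) := by
      intro t
      simp [Circuit.run]
    rw [h2, ih, Gate.act_act]

/-- Every gate is an involution, so the reversed circuit undoes the circuit at the same cost. This
provides division by 1 + X^k and by 1 + X from the corresponding multiplications. -/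
lemma Implements.exists_inverse {N : ℕ} {F : (ι → ZMod 2) → (ι → ZMod 2)} (hF : Implements N F) :
    ∃ G, Implements N G ∧ (∀ s, G (F s) = s) ∧ ∀ s, F (G s) = s := by
  obtain ⟨c, hc, hc'⟩ := hF
  refine ⟨Circuit.run c.reverse, ⟨c.reverse, by simpa using hc, fun _ => rfl⟩, fun s => ?_,
    fun s => ?_⟩
  · rw [← hc', Circuit.run_reverse_run]
  · rw [← hc']
    simpa using Circuit.run_reverse_run c.reverse s

lemma implements_cnot {a t : ι} (h : a ≠ t) :
    Implements 1 (fun s => s + Pi.single t (s a)) := by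
  refine ⟨[Gate.cnot a t h], le_rfl, fun s => ?_⟩
  ext w
  by_cases hw : w = t
  · subst hw
    simp [Circuit.run, Gate.act]
  · simp [Circuit.run, Gate.act, hw]

lemma implements_toffoli {a b t : ι} (hab : a ≠ b) (ha : a ≠ t) (hb : b ≠ t) :
    Implements 1 (fun s => s + Pi.single t (s a * s b)) := by
  refine ⟨[Gate.toffoli a b t hab ha hb], le_rfl, fun s => ?_⟩
  ext w
  by_cases hw : w = t
  · subst hw
    simp [Circuit.run, Gate.act]
  · simp [Circuit.run, Gate.act, hw]

lemma implements_add_sum {κ : Type*} (J : Finset κ) (w : κ → ι) {t : ι}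
    (h : ∀ j ∈ J, w j ≠ t) : Implements J.card (fun s => s + Pi.single t (∑ j ∈ J, s (w j))) := by
  classical
  induction J using Finset.induction_on with
  | empty => exact Implements.id.congr (by simp)
  | insert j J hj ih =>
    rw [Finset.card_insert_of_notMem hj]
    refine ((implements_cnot (h j (by simp))).comp
      (ih fun i hi => h i (by simp [hi]))).congr fun s => ?_
    have : w j ≠ t := h j (by simp)
    rw [Finset.sum_insert hj, add_comm (s (w j)), Pi.single_add]
    simp [this, add_assoc]

/-- In-place addition of one register to another. -/
lemma implements_add_reg {r r' : ℕ → ι} {n : ℕ} (h : Apart r n r' n) :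
    Implements n (fun s => s + writeReg r n (readReg r' n s)) := by
  induction n with
  | zero => exact Implements.id.congr (by simp [writeReg_eq_sum])
  | succ n ih =>
    refine ((implements_cnot (h n (by omega) n (by omega)).symm).comp
      (ih (h.mono (by omega) (by omega)))).congr fun s => ?_
    have h0 : writeReg r n (readReg r' n s) (r' n) = 0 :=
      writeReg_apply_of_ne _ fun i hi => h i (by omega) n (by omega)
    rw [writeReg_eq_sum r (n + 1), Finset.sum_range_succ, Pi.add_apply, h0, add_zero, add_assoc,
      coeff_readReg, if_pos (Nat.lt_succ_self n), writeReg_eq_sum]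
    congr 2
    refine Finset.sum_congr rfl fun i hi => ?_
    have := Finset.mem_range.1 hi
    rw [coeff_readReg, coeff_readReg, if_pos (by omega), if_pos (by omega)]

/-- Adding to each wire of a register a fixed combination of the wires below it. -/
lemma implements_triangular {h : ℕ → ι} {N k : ℕ} (hh : Distinct h N) (Q : (ZMod 2)[X])
    (hQ : Q.coeff 0 = 0) (hk : k ≤ N) :
    Implements (N * Q.support.card) (fun s => s + writeReg h N (Q * readReg h k s)) := by
  suffices H : ∀ M ≤ N, Implements (M * Q.support.card)
      (fun s => s + writeReg h M (Q * readReg h k s)) from H N le_rfl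
  intro M hM
  induction M with
  | zero => exact Implements.id.congr (by simp [writeReg_eq_sum]) |>.mono (by omega)
  | succ M ih =>
    have hcoeff : ∀ s : ι → ZMod 2, (Q * readReg h k s).coeff M =
        ∑ j ∈ Q.support.filter (fun j => j ≤ M ∧ M - j < k), s (h (M - j)) := by
      intro s
      rw [coeff_mul_eq_sum_support, Finset.sum_filter]
      refine Finset.sum_congr rfl fun j _ => ?_
      rw [coeff_readReg]
      split_ifs <;> first | rfl | omega
    have h1 : Implements Q.support.card
        (fun s => s + Pi.single (h M) ((Q * readReg h k s).coeff M)) := by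
      refine ((implements_add_sum (Q.support.filter (fun j => j ≤ M ∧ M - j < k))
        (fun j => h (M - j)) (t := h M) ?_).congr fun s => by rw [hcoeff]).mono
          (Finset.card_filter_le _ _)
      intro j hj e
      rw [Finset.mem_filter] at hj
      have := hh (M - j) (by omega) M (by omega) e
      have hj0 : j = 0 := by omega
      rw [hj0, Polynomial.mem_support_iff] at hj
      exact hj.1 hQ
    -- The top wire is updated first. No lower wire depends on it, so the remaining updates still
    -- read original values.
    refine ((ih (by omega)).comp h1).congr (fun s => ?_) |>.mono (by ring_nf; rfl)
    rw [writeReg_eq_sum h (M + 1), Finset.sum_range_succ, add_assoc, add_comm (Finset.sum _ _),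
      ← writeReg_eq_sum]
    congr 2
    refine writeReg_congr h fun i hi => ?_
    rw [map_add, mul_add, Polynomial.coeff_add, add_eq_left, coeff_mul_eq_sum_support]
    refine Finset.sum_eq_zero fun j _ => ?_
    rw [coeff_readReg]
    split_ifs with h1 h2
    · rw [Pi.single_eq_of_ne]
      intro e
      have := hh (i - j) (by omega) M (by omega) e
      omega
    · rfl
    · rfl

end Circuits

/-! ### Karatsuba and truncated products without ancillas -/

section Products

variable {ι : Type}

/-- Two input registers of `n` wires and an output register of `p` wires, all distinct. -/
structure MulRegs (f g h : ℕ → ι) (n p : ℕ) : Prop where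
  left : Distinct f n
  right : Distinct g n
  out : Distinct h p
  left_right : Apart f n g n
  left_out : Apart f n h p
  right_out : Apart g n h p

lemma MulRegs.sub {f g h : ℕ → ι} {n p : ℕ} (R : MulRegs f g h n p) (a b c : ℕ) {n' p' : ℕ}
    (ha : a + n' ≤ n) (hb : b + n' ≤ n) (hc : c + p' ≤ p) :
    MulRegs (fun i => f (a + i)) (fun i => g (b + i)) (fun i => h (c + i)) n' p' where
  left := R.left.shift ha
  right := R.right.shift hb
  out := R.out.shift hc
  left_right := (R.left_right.shift_left ha).shift_right hb
  left_out := (R.left_out.shift_left ha).shift_right hc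
  right_out := (R.right_out.shift_left hb).shift_right hc

lemma add_self_state (x : ι → ZMod 2) : x + x = 0 := by
  ext w
  exact CharTwo.add_self_eq_zero (x w)

variable [DecidableEq ι]

/-- The map `|f, g, h⟩ ↦ |f, g, h + f g⟩`, where `f` and `g` are polynomials with `n`
coefficients and `h` is taken modulo `X ^ p`. -/
noncomputable def mulAdd (f g h : ℕ → ι) (n p : ℕ) (s : ι → ZMod 2) : ι → ZMod 2 :=
  s + writeReg h p (readReg f n s * readReg g n s)

lemma degree_mul_lt_of_lt {p q : (ZMod 2)[X]} {a b N : ℕ} (hp : p.degree < a) (hq : q.degree < b)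
    (h : a + b ≤ N + 1) : (p * q).degree < N := by
  rcases eq_or_ne p 0 with rfl | hp0
  · simp
  rcases eq_or_ne q 0 with rfl | hq0
  · simp
  rw [Polynomial.degree_eq_natDegree hp0, Nat.cast_lt] at hp
  rw [Polynomial.degree_eq_natDegree hq0, Nat.cast_lt] at hq
  rw [Polynomial.degree_mul, Polynomial.degree_eq_natDegree hp0,
    Polynomial.degree_eq_natDegree hq0, ← Nat.cast_add, Nat.cast_lt]
  omega

lemma degree_X_pow_mul_lt {p : (ZMod 2)[X]} {a k N : ℕ} (hp : p.degree < a) (h : k + a ≤ N) :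
    (X ^ k * p).degree < (N : WithBot ℕ) :=
  degree_mul_lt_of_lt (a := k + 1) (by rw [Polynomial.degree_X_pow]; exact_mod_cast Nat.lt_succ_self k)
    hp (by omega)

lemma degree_add_lt_of_lt {p q : (ZMod 2)[X]} {N : ℕ} (hp : p.degree < N) (hq : q.degree < N) :
    (p + q).degree < N :=
  (Polynomial.degree_add_le p q).trans_lt (max_lt hp hq)

lemma degree_lt_mono {p : (ZMod 2)[X]} {n N : ℕ} (hp : p.degree < n) (h : n ≤ N) :
    p.degree < N := hp.trans_le (by exact_mod_cast h)

/-- Conjugation by the map L that multiplies h by 1 + X^k modulo X^N: L(L⁻¹h + p) = h + (1 + X^k)p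
whenever deg p < N. The two half-size products overlap in h, which is harmless because each is added
to what is there. L and its inverse cost N gates each. -/
lemma implements_karatsuba_outer {f g h : ℕ → ι} {k l N T : ℕ} (hk : 0 < k) (hl : 0 < l)
    (hN : N + 1 = 2 * (k + l)) (R : MulRegs f g h (k + l) N)
    (h0 : Implements T (mulAdd f g h k (2 * k - 1)))
    (h1 : Implements T (mulAdd (fun i => f (k + i)) (fun i => g (k + i)) (fun i => h (k + i))
      l (2 * l - 1))) :
    Implements (2 * T + 2 * N) (fun s => s + writeReg h N ((1 + X ^ k) *
      (readReg f k s * readReg g k s + X ^ k * (readReg (fun i => f (k + i)) l s *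
        readReg (fun i => g (k + i)) l s)))) := by
  have hL : Implements N (fun s => s + writeReg h N (X ^ k * readReg h N s)) :=
    (implements_triangular R.out (X ^ k) (by simp [Polynomial.coeff_X_pow, hk.ne]) le_rfl).mono
      (by rw [Polynomial.support_X_pow]; simp)
  obtain ⟨G, hG, -, hLG⟩ := hL.exists_inverse
  refine ((hL.comp (h1.comp (h0.comp hG)))).congr (fun s => ?_) |>.mono (by omega)
  have hf : ∀ a n, a + n ≤ k + l → readReg (fun i => f (a + i)) n (G s) =
      readReg (fun i => f (a + i)) n s := by
    intro a n han
    conv_rhs => rw [← hLG s]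
    rw [map_add, readReg_writeReg_of_apart (R.left_out.shift_left han), add_zero]
  have hg : ∀ a n, a + n ≤ k + l → readReg (fun i => g (a + i)) n (G s) =
      readReg (fun i => g (a + i)) n s := by
    intro a n han
    conv_rhs => rw [← hLG s]
    rw [map_add, readReg_writeReg_of_apart (R.right_out.shift_left han), add_zero]
  have hf0 : readReg f k (G s) = readReg f k s := by simpa using hf 0 k (by omega)
  have hg0 : readReg g k (G s) = readReg g k s := by simpa using hg 0 k (by omega)
  have hf1 := hf k l le_rfl
  have hg1 := hg k l le_rfl
  set F0 := readReg f k s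
  set G0 := readReg g k s
  set F1 := readReg (fun i => f (k + i)) l s
  set G1 := readReg (fun i => g (k + i)) l s
  have d0 : (F0 * G0).degree < (2 * k - 1 : ℕ) :=
    degree_mul_lt_of_lt (degree_readReg_lt _ _ _) (degree_readReg_lt _ _ _) (by omega)
  have d1 : (F1 * G1).degree < (2 * l - 1 : ℕ) :=
    degree_mul_lt_of_lt (degree_readReg_lt _ _ _) (degree_readReg_lt _ _ _) (by omega)
  have dsum : (F0 * G0 + X ^ k * (F1 * G1)).degree < (N : WithBot ℕ) :=
    degree_add_lt_of_lt (degree_lt_mono d0 (by omega)) (degree_X_pow_mul_lt d1 (by omega))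
  have e0 : mulAdd f g h k (2 * k - 1) (G s) = G s + writeReg h N (F0 * G0) := by
    rw [mulAdd, hf0, hg0, writeReg_extend h (m := N) (by omega) d0]
  have e1 : mulAdd (fun i => f (k + i)) (fun i => g (k + i)) (fun i => h (k + i)) l (2 * l - 1)
      (mulAdd f g h k (2 * k - 1) (G s)) =
        G s + writeReg h N (F0 * G0 + X ^ k * (F1 * G1)) := by
    rw [e0, mulAdd, map_add, map_add,
      readReg_writeReg_of_apart (R.left_out.shift_left le_rfl),
      readReg_writeReg_of_apart (R.right_out.shift_left le_rfl), add_zero, add_zero, hf1, hg1,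
      writeReg_shift, writeReg_extend h (m := N) (by omega) (degree_X_pow_mul_lt d1 le_rfl),
      map_add, add_assoc]
  rw [e1]
  generalize F0 * G0 + X ^ k * (F1 * G1) = p at dsum
  conv_rhs => rw [← hLG s]
  rw [map_add (readReg h N), readReg_writeReg R.out dsum, mul_add, add_mul, one_mul, map_add,
    map_add]
  abel

/-- The upper halves are folded onto the lower halves of f and g, one product is computed, and the
folding is undone, for four additions of `l` gates. The product, placed at offset k, takes 2k - 1
wires and fits into h exactly when k ≤ 2l. -/
lemma implements_karatsuba_middle {f g h : ℕ → ι} {k l N T : ℕ}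
    (hlk : l ≤ k) (hkl : k ≤ 2 * l) (hN : N + 1 = 2 * (k + l)) (R : MulRegs f g h (k + l) N)
    (h01 : Implements T (mulAdd f g (fun i => h (k + i)) k (2 * k - 1))) :
    Implements (T + 4 * l) (fun s => s + writeReg h N (X ^ k *
      ((readReg f k s + readReg (fun i => f (k + i)) l s) *
        (readReg g k s + readReg (fun i => g (k + i)) l s)))) := by
  have af : Apart f l (fun i => f (k + i)) l := (R.left.apart_shift le_rfl).mono hlk le_rfl
  have ag : Apart g l (fun i => g (k + i)) l := (R.right.apart_shift le_rfl).mono hlk le_rfl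
  have hA := implements_add_reg af
  have hB := implements_add_reg ag
  refine ((hA.comp (hB.comp (h01.comp (hB.comp hA))))).congr (fun s => ?_) |>.mono (by omega)
  set F0 := readReg f k s with hF0
  set G0 := readReg g k s with hG0
  set F1 := readReg (fun i => f (k + i)) l s with hF1
  set G1 := readReg (fun i => g (k + i)) l s with hG1
  have dF1 : F1.degree < l := degree_readReg_lt _ _ _
  have dG1 : G1.degree < l := degree_readReg_lt _ _ _
  have fg1 : readReg (fun i => g (k + i)) l (writeReg f l F1) = 0 :=
    readReg_writeReg_of_apart (((R.left_right.mono (n' := l) (by omega) le_rfl).symm.shift_left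
      le_rfl)) _
  have gf1 : readReg (fun i => f (k + i)) l (writeReg g l G1) = 0 :=
    readReg_writeReg_of_apart (((R.left_right.mono (m' := l) le_rfl (by omega)).shift_left
      le_rfl)) _
  have fg0 : readReg g k (writeReg f l F1) = 0 :=
    readReg_writeReg_of_apart ((R.left_right.mono (by omega) (by omega)).symm) _
  have gf0 : readReg f k (writeReg g l G1) = 0 :=
    readReg_writeReg_of_apart ((R.left_right.mono (by omega) (by omega))) _
  have ff1 : readReg (fun i => f (k + i)) l (writeReg f l F1) = 0 :=
    readReg_writeReg_of_apart af.symm _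
  have gg1 : readReg (fun i => g (k + i)) l (writeReg g l G1) = 0 :=
    readReg_writeReg_of_apart ag.symm _
  have ff0 : readReg f k (writeReg f l F1) = F1 := by
    rw [writeReg_extend f hlk dF1, readReg_writeReg (R.left.mono (by omega)) (degree_lt_mono dF1 hlk)]
  have gg0 : readReg g k (writeReg g l G1) = G1 := by
    rw [writeReg_extend g hlk dG1, readReg_writeReg (R.right.mono (by omega)) (degree_lt_mono dG1 hlk)]
  have d01 : ((F0 + F1) * (G0 + G1)).degree < (2 * k - 1 : ℕ) :=
    degree_mul_lt_of_lt
      (degree_add_lt_of_lt (degree_readReg_lt _ _ _) (degree_lt_mono dF1 hlk))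
      (degree_add_lt_of_lt (degree_readReg_lt _ _ _) (degree_lt_mono dG1 hlk)) (by omega)
  have e1 : mulAdd f g (fun i => h (k + i)) k (2 * k - 1) (s + writeReg f l F1 + writeReg g l G1) =
      s + writeReg f l F1 + writeReg g l G1 +
        writeReg h N (X ^ k * ((F0 + F1) * (G0 + G1))) := by
    rw [mulAdd, map_add, map_add, map_add, map_add, ff0, gg0, fg0, gf0, add_zero, add_zero,
      writeReg_shift, writeReg_extend h (m := N) (by omega) (degree_X_pow_mul_lt d01 le_rfl)]
  have fh1 : ∀ p, readReg (fun i => f (k + i)) l (writeReg h N p) = 0 :=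
    fun p => readReg_writeReg_of_apart (R.left_out.shift_left le_rfl) _
  have gh1 : ∀ p, readReg (fun i => g (k + i)) l (writeReg h N p) = 0 :=
    fun p => readReg_writeReg_of_apart (R.right_out.shift_left le_rfl) _
  rw [map_add (readReg (fun i => g (k + i)) l), ← hG1, fg1, add_zero, e1]
  simp only [map_add, fg1, gf1, ff1, gg1, fh1, gh1, ← hF1, ← hG1, add_zero]
  generalize writeReg h N _ = x
  have hx := add_self_state (writeReg f l F1)
  have hy := add_self_state (writeReg g l G1)
  generalize writeReg f l F1 = y at *
  generalize writeReg g l G1 = z at *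
  calc s + y + z + x + z + y = s + x + (y + y) + (z + z) := by abel
    _ = s + x := by rw [hx, hy, add_zero, add_zero]

/-- Karatsuba multiplication without ancillas. -/
theorem implements_mulAdd_full (t : ℕ) : ∀ n ≤ 2 ^ t, ∀ f g h : ℕ → ι,
    MulRegs f g h n (2 * n - 1) →
      Implements (13 * 3 ^ t - 12 * 2 ^ t) (mulAdd f g h n (2 * n - 1)) := by
  have hone : ∀ f g h : ℕ → ι, MulRegs f g h 1 1 → Implements 1 (mulAdd f g h 1 1) := by
    intro f g h R
    refine (implements_toffoli (R.left_right 0 one_pos 0 one_pos) (R.left_out 0 one_pos 0 one_pos)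
      (R.right_out 0 one_pos 0 one_pos)).congr fun s => ?_
    simp [mulAdd, readReg_eq_sum, writeReg_eq_sum]
  -- The natural subtraction in the bound never truncates, and the bound is at least one gate.
  have hpow : ∀ t, 12 * 2 ^ t + 1 ≤ 13 * 3 ^ t := by
    intro t
    have := Nat.pow_le_pow_left (show 2 ≤ 3 by norm_num) t
    have := Nat.one_le_pow t 3 (by norm_num)
    omega
  induction t with
  | zero =>
    intro n hn f g h R
    obtain rfl | rfl : n = 0 ∨ n = 1 := by simp at hn; omega
    · exact (Implements.id.congr fun s => by simp [mulAdd, writeReg_eq_sum]).mono (by omega)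
    · exact (hone f g h R).mono (by norm_num)
  | succ t ih =>
    intro n hn f g h R
    have hp := hpow t
    have hp' := hpow (t + 1)
    rcases Nat.lt_or_ge n 2 with h2 | h2
    · obtain rfl | rfl : n = 0 ∨ n = 1 := by omega
      · exact (Implements.id.congr fun s => by simp [mulAdd, writeReg_eq_sum]).mono (by omega)
      · exact (hone f g h R).mono (by omega)
    obtain ⟨k, l, rfl, hlk, hkl⟩ : ∃ k l, n = k + l ∧ l ≤ k ∧ k ≤ l + 1 :=
      ⟨(n + 1) / 2, n / 2, by omega, by omega, by omega⟩
    rw [pow_succ] at hn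
    have hN : 2 * (k + l) - 1 + 1 = 2 * (k + l) := by omega
    have o := implements_karatsuba_outer (T := 13 * 3 ^ t - 12 * 2 ^ t) (by omega) (by omega) hN R
      (ih k (by omega) f g h (by simpa using R.sub 0 0 0 (n' := k) (by omega) (by omega) (by omega)))
      (ih l (by omega) _ _ _ (R.sub k k k (by omega) (by omega) (by omega)))
    have m := implements_karatsuba_middle (T := 13 * 3 ^ t - 12 * 2 ^ t) hlk (by omega) hN R
      (ih k (by omega) f g _ (by simpa using R.sub 0 0 k (n' := k) (by omega) (by omega) (by omega)))
    -- Here 2N + 4l ≤ 6(k + l) ≤ 12 * 2^t, and T = 13 * 3^t - 12 * 2^t satisfies 3T + 12 * 2^t = 13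
    -- * 3^(t+1) - 12 * 2^(t+1).
    refine (m.comp o).congr (fun s => ?_) |>.mono (by rw [pow_succ, pow_succ]; omega)
    have fh1 : ∀ p, readReg (fun i => f (k + i)) l (writeReg h (2 * (k + l) - 1) p) = 0 :=
      fun p => readReg_writeReg_of_apart (R.left_out.shift_left le_rfl) _
    have gh1 : ∀ p, readReg (fun i => g (k + i)) l (writeReg h (2 * (k + l) - 1) p) = 0 :=
      fun p => readReg_writeReg_of_apart (R.right_out.shift_left le_rfl) _
    have fh0 : ∀ p, readReg f k (writeReg h (2 * (k + l) - 1) p) = 0 :=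
      fun p => readReg_writeReg_of_apart (R.left_out.mono (by omega) le_rfl) _
    have gh0 : ∀ p, readReg g k (writeReg h (2 * (k + l) - 1) p) = 0 :=
      fun p => readReg_writeReg_of_apart (R.right_out.mono (by omega) le_rfl) _
    simp only [mulAdd, map_add, fh0, gh0, fh1, gh1, add_zero, readReg_add_eq]
    rw [add_assoc]
    congr 1
    simp only [← map_add]
    congr 1
    generalize readReg f k s = F0
    generalize readReg g k s = G0
    generalize readReg (fun i => f (k + i)) l s = F1
    generalize readReg (fun i => g (k + i)) l s = G1
    linear_combination (X ^ k * (F0 * G0) + X ^ k * (F1 * G1)) * two_eq_zero_poly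

/-- Multiplication modulo `X ^ n` without ancillas. -/
theorem implements_mulAdd_short (t : ℕ) : ∀ n ≤ 2 ^ t, ∀ f g h : ℕ → ι,
    MulRegs f g h n n → Implements (13 * 3 ^ t) (mulAdd f g h n n) := by
  have hone : ∀ f g h : ℕ → ι, MulRegs f g h 1 1 → Implements 1 (mulAdd f g h 1 1) :=
    fun f g h R => implements_mulAdd_full 0 1 le_rfl f g h R
  induction t with
  | zero =>
    intro n hn f g h R
    obtain rfl | rfl : n = 0 ∨ n = 1 := by simp at hn; omega
    · exact (Implements.id.congr fun s => by simp [mulAdd, writeReg_eq_sum]).mono (by omega)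
    · exact (hone f g h R).mono (by norm_num)
  | succ t ih =>
    intro n hn f g h R
    have hp : 1 ≤ 3 ^ (t + 1) := Nat.one_le_pow _ _ (by norm_num)
    rcases Nat.lt_or_ge n 2 with h2 | h2
    · obtain rfl | rfl : n = 0 ∨ n = 1 := by omega
      · exact (Implements.id.congr fun s => by simp [mulAdd, writeReg_eq_sum]).mono (by omega)
      · exact (hone f g h R).mono (by omega)
    obtain ⟨k, l, rfl, hlk, hkl⟩ : ∃ k l, n = k + l ∧ l ≤ k ∧ k ≤ l + 1 :=
      ⟨(n + 1) / 2, n / 2, by omega, by omega, by omega⟩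
    rw [pow_succ] at hn
    -- The low product has degree below 2k - 1 ≤ k + l, so it is needed in full. The cross terms
    -- carry a factor X^k and matter only modulo X^l; the term f₁g₁ disappears.
    have c0 := implements_mulAdd_full t k (by omega) f g h
      (by simpa using R.sub 0 0 0 (n' := k) (p' := 2 * k - 1) (by omega) (by omega) (by omega))
    have c1 := ih l (by omega) f (fun i => g (k + i)) (fun i => h (k + i))
      (by simpa using R.sub 0 k k (n' := l) (p' := l) (by omega) (by omega) (by omega))
    have c2 := ih l (by omega) (fun i => f (k + i)) g (fun i => h (k + i))
      (by simpa using R.sub k 0 k (n' := l) (p' := l) (by omega) (by omega) (by omega))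
    refine (c2.comp (c1.comp c0)).congr (fun s => ?_) |>.mono (by rw [pow_succ]; omega)
    have fh : ∀ a n m p, a + n ≤ k + l → m ≤ k + l →
        readReg (fun i => f (a + i)) n (writeReg h m p) = 0 :=
      fun a n m p h h' => readReg_writeReg_of_apart
        ((R.left_out.shift_left h).mono le_rfl h') _
    have gh : ∀ a n m p, a + n ≤ k + l → m ≤ k + l →
        readReg (fun i => g (a + i)) n (writeReg h m p) = 0 :=
      fun a n m p h h' => readReg_writeReg_of_apart
        ((R.right_out.shift_left h).mono le_rfl h') _
    have fh0 : ∀ n m p, n ≤ k + l → m ≤ k + l → readReg f n (writeReg h m p) = 0 :=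
      fun n m p h h' => by simpa using fh 0 n m p (by omega) h'
    have gh0 : ∀ n m p, n ≤ k + l → m ≤ k + l → readReg g n (writeReg h m p) = 0 :=
      fun n m p h h' => by simpa using gh 0 n m p (by omega) h'
    have d0 : (readReg f k s * readReg g k s).degree < (2 * k - 1 : ℕ) :=
      degree_mul_lt_of_lt (degree_readReg_lt _ _ _) (degree_readReg_lt _ _ _) (by omega)
    simp only [mulAdd]
    rw [writeReg_extend h (by omega : 2 * k - 1 ≤ k + l) d0, writeReg_shift, writeReg_shift]
    simp only [map_add, fh k l (k + l) _ le_rfl le_rfl, gh k l (k + l) _ le_rfl le_rfl,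
      fh0 l (k + l) _ (by omega) le_rfl, gh0 l (k + l) _ (by omega) le_rfl, add_zero]
    rw [add_assoc, add_assoc]
    congr 1
    simp only [← map_add]
    refine writeReg_congr h fun i hi => ?_
    -- The cross products read only l low wires, although the low half has k. The discarded part is
    -- a multiple of X^l, so it vanishes modulo X^(k+l) after the factor X^k.
    have trunc : ∀ (r : ℕ → ι), ∃ q, readReg r k s = readReg r l s + X ^ l * q := by
      intro r
      obtain ⟨d, rfl⟩ := Nat.exists_eq_add_of_le hlk
      exact ⟨_, readReg_add_eq r l d s⟩
    obtain ⟨p, hp⟩ := trunc f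
    obtain ⟨q, hq⟩ := trunc g
    have key : readReg f (k + l) s * readReg g (k + l) s =
        (readReg f k s * readReg g k s +
          (X ^ k * (readReg f l s * readReg (fun i => g (k + i)) l s) +
            X ^ k * (readReg (fun i => f (k + i)) l s * readReg g l s))) +
        X ^ (k + l) * (p * readReg (fun i => g (k + i)) l s +
          readReg (fun i => f (k + i)) l s * q + X ^ (k - l) *
          (readReg (fun i => f (k + i)) l s * readReg (fun i => g (k + i)) l s)) := by
      rw [readReg_add_eq, readReg_add_eq, mul_add (X ^ (k + l)), ← mul_assoc (X ^ (k + l)),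
        ← pow_add, show k + l + (k - l) = k + k by omega]
      linear_combination X ^ k * readReg (fun i => g (k + i)) l s * hp +
        X ^ k * readReg (fun i => f (k + i)) l s * hq
    rw [key, Polynomial.coeff_add _ (X ^ (k + l) * _), Polynomial.coeff_X_pow_mul',
      if_neg (by omega), add_zero]

end Products

lemma degree_X_pow_add {p : (ZMod 2)[X]} {n : ℕ} (hp : p.degree < n) :
    (X ^ n + p).degree = (n : WithBot ℕ) := by
  rw [Polynomial.degree_add_eq_left_of_degree_lt (by rwa [Polynomial.degree_X_pow]),
    Polynomial.degree_X_pow]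

/-! ### In-place multiplication by powers of X modulo X^m + Q -/

section Shift

variable {ι : Type} [DecidableEq ι]

/-- The core of the in-place multiplication by `X ^ j` modulo `X ^ m + Q`: the low `j` wires of a
register are multiplied by `Q`, a polynomial for which `(1 + X) * Q` is sparse. -/
lemma implements_mul_low {r : ℕ → ι} {j l W : ℕ} (hr : Distinct r (j + l)) {Q : (ZMod 2)[X]}
    (hQ0 : Q.coeff 0 = 1) (hQ : Q.natDegree ≤ l) (hW : ((1 + X) * Q).support.card ≤ W) :
    Implements ((j + l) * (W + 2)) (fun s => s + writeReg r (j + l) (readReg r (j + l) s +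
      (readReg r j s * Q + X ^ j * readReg (fun i => r (j + i)) l s))) := by
  have hD0 : (((1 + X) * Q).erase 0).coeff 0 = 0 := Polynomial.erase_same _ _
  have hD : (1 + X) * Q = 1 + ((1 + X) * Q).erase 0 := by
    conv_lhs => rw [← Polynomial.monomial_add_erase ((1 + X) * Q) 0]
    rw [Polynomial.mul_coeff_zero, hQ0]
    simp
  have hDW : (((1 + X) * Q).erase 0).support.card ≤ W := by
    rw [Polynomial.support_erase]
    exact Finset.card_erase_le.trans hW
  generalize ((1 + X) * Q).erase 0 = D at hD0 hD hDW
  have hE : Implements (j + l) (fun s => s + writeReg r (j + l) (X * readReg r (j + l) s)) :=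
    (implements_triangular hr X (by simp) le_rfl).mono
      (by simp)
  have hG1 : Implements l (fun s => s + writeReg (fun i => r (j + i)) l
      (X * readReg (fun i => r (j + i)) l s)) :=
    (implements_triangular (hr.shift le_rfl) X (by simp) le_rfl).mono
      (by simp)
  have hG2 : Implements ((j + l) * W) (fun s => s + writeReg r (j + l) (D * readReg r j s)) :=
    (implements_triangular hr D hD0 (by omega)).mono (Nat.mul_le_mul_left _ hDW)
  obtain ⟨E', hE', hE1, -⟩ := hE.exists_inverse
  -- With (1 + X)Q = 1 + D, the target y = uQ + X^j v satisfies (1 + X)y = u + Du + X^j (1 + X)v.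
  -- The high block is multiplied by 1 + X, then Du is added, and finally the whole register is
  -- divided by 1 + X, all modulo X^(j+l). Since D has no constant term, adding Du is triangular.
  refine (hE'.comp (hG2.comp hG1)).congr (fun s => ?_) |>.mono (by
    rw [mul_add, mul_two]; omega)
  -- Adding old plus new content overwrites the register with the new content. It remains to compare
  -- both sides before the division by 1 + X.
  conv_rhs => rw [← hE1 (s + _)]
  congr 1
  have a1 : readReg r j (writeReg (fun i => r (j + i)) l
      (X * readReg (fun i => r (j + i)) l s)) = 0 :=
    readReg_writeReg_of_apart (hr.apart_shift le_rfl) _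
  have hu : (readReg r j s).degree < (j : WithBot ℕ) := degree_readReg_lt _ _ _
  have hv : (readReg (fun i => r (j + i)) l s).degree < (l : WithBot ℕ) := degree_readReg_lt _ _ _
  have hQd : Q.degree < ((l + 1 : ℕ) : WithBot ℕ) :=
    Polynomial.degree_le_natDegree.trans_lt (by exact_mod_cast Nat.lt_succ_of_le hQ)
  have hd : (readReg r (j + l) s + (readReg r j s * Q + X ^ j *
      readReg (fun i => r (j + i)) l s)).degree < ((j + l : ℕ) : WithBot ℕ) :=
    degree_add_lt_of_lt (degree_readReg_lt _ _ _) (degree_add_lt_of_lt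
      (degree_mul_lt_of_lt hu hQd (by omega)) (degree_X_pow_mul_lt hv le_rfl))
  rw [map_add (readReg r j), a1, add_zero, map_add (readReg r (j + l)), readReg_writeReg hr hd,
    writeReg_shift, readReg_add_eq]
  simp only [add_assoc, ← map_add]
  congr 2
  generalize readReg r j s = u
  generalize readReg (fun i => r (j + i)) l s = v
  linear_combination (-u) * hD - (u + X ^ j * v + X * (u + X ^ j * v)) * two_eq_zero_poly

/-- In-place multiplication by `X ^ j` modulo `X ^ m + Q`; the result is read on the wires of the
register rotated by `j` places. -/
lemma implements_mul_X_pow {r r' : ℕ → ι} {j l W : ℕ} (hr : Distinct r' (j + l)) {Q : (ZMod 2)[X]}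
    (hlow : ∀ i < j, r' i = r (l + i)) (hhigh : ∀ i < l, r' (j + i) = r i)
    (hQ0 : Q.coeff 0 = 1) (hQ : Q.natDegree ≤ l) (hj : 0 < j)
    (hW : ((1 + X) * Q).support.card ≤ W) :
    ∃ F : (ι → ZMod 2) → ι → ZMod 2, Implements ((j + l) * (W + 2)) F ∧
      (∀ s, readReg r' (j + l) (F s) = (X ^ j * readReg r (j + l) s) %ₘ (X ^ (j + l) + Q)) ∧
      ∀ s w, (∀ i < j + l, r' i ≠ w) → F s w = s w := by
  refine ⟨_, implements_mul_low hr hQ0 hQ hW, fun s => ?_, fun s w hw => ?_⟩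
  · have hu : (readReg r' j s).degree < (j : WithBot ℕ) := degree_readReg_lt _ _ _
    have hv : (readReg (fun i => r' (j + i)) l s).degree < (l : WithBot ℕ) :=
      degree_readReg_lt _ _ _
    have hQd : Q.degree < ((l + 1 : ℕ) : WithBot ℕ) :=
      Polynomial.degree_le_natDegree.trans_lt (by exact_mod_cast Nat.lt_succ_of_le hQ)
    have hy : (readReg r' j s * Q + X ^ j * readReg (fun i => r' (j + i)) l s).degree <
        ((j + l : ℕ) : WithBot ℕ) :=
      degree_add_lt_of_lt (degree_mul_lt_of_lt hu hQd (by omega)) (degree_X_pow_mul_lt hv le_rfl)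
    have hm : (X ^ (j + l) + Q).Monic :=
      Polynomial.monic_X_pow_add (hQd.trans_le (by exact_mod_cast (by omega : l + 1 ≤ j + l)))
    have hdeg : (X ^ (j + l) + Q).degree = ((j + l : ℕ) : WithBot ℕ) :=
      degree_X_pow_add
        (hQd.trans_le (by exact_mod_cast (by omega : l + 1 ≤ j + l)))
    have e1 : readReg r' j s = readReg (fun i => r (l + i)) j s := by
      ext i
      rw [coeff_readReg, coeff_readReg]
      split_ifs with hi
      · rw [hlow i hi]
      · rfl
    have e2 : readReg (fun i => r' (j + i)) l s = readReg r l s := by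
      ext i
      rw [coeff_readReg, coeff_readReg]
      split_ifs with hi
      · rw [hhigh i hi]
      · rfl
    rw [map_add, readReg_writeReg hr
      (degree_add_lt_of_lt (degree_readReg_lt _ _ _) hy), ← add_assoc,
      show readReg r' (j + l) s + readReg r' (j + l) s = 0 from CharTwo.add_self_eq_zero _,
      zero_add]
    refine ((Polynomial.modByMonic_eq_self_iff hm).2 (hdeg ▸ hy)).symm.trans ?_
    apply Polynomial.modByMonic_eq_of_dvd_sub hm
    -- The quotient is the block of top coefficients that wraps around.
    refine ⟨readReg r' j s, ?_⟩
    rw [add_comm j l, readReg_add_eq r l j, e1, e2]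
    linear_combination (-(X ^ (j + l) * readReg (fun i => r (l + i)) j s)) * two_eq_zero_poly
  · rw [Pi.add_apply, writeReg_apply_of_ne _ hw, add_zero]

end Shift

/-! ### Assembling the field multiplier -/

section Multiplier

/-- The wires of register `a`, numbered cyclically. -/
def wire {m : ℕ} (hm : 0 < m) (a : Fin 3) (i : ℕ) : Wire m := (a, ⟨i % m, Nat.mod_lt i hm⟩)

lemma wire_inj {m : ℕ} (hm : 0 < m) {a : Fin 3} {i j : ℕ} (hi : i < m) (hj : j < m)
    (e : wire hm a i = wire hm a j) : i = j := by
  have := congrArg (fun w => (w.2 : ℕ)) e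
  simpa [wire, Nat.mod_eq_of_lt hi, Nat.mod_eq_of_lt hj] using this

lemma wire_ne {m : ℕ} (hm : 0 < m) {a b : Fin 3} (hab : a ≠ b) (i j : ℕ) :
    wire hm a i ≠ wire hm b j := fun e => hab (congrArg Prod.fst e)

lemma ket_wire {m : ℕ} (hm : 0 < m) (a b c : Fin m → ZMod 2) (x : Fin 3) {i : ℕ} (hi : i < m) :
    ket a b c (wire hm x i) = (![a, b, c] x) ⟨i, hi⟩ := by
  simp [ket, wire, Nat.mod_eq_of_lt hi]

lemma coeff_toPoly {m : ℕ} (a : Fin m → ZMod 2) (i : ℕ) :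
    (toPoly a).coeff i = if h : i < m then a ⟨i, h⟩ else 0 := by
  simp only [toPoly, Polynomial.finsetSum_coeff, Polynomial.coeff_C_mul_X_pow]
  split_ifs with h
  · rw [Finset.sum_eq_single ⟨i, h⟩]
    · simp
    · intro j _ hj
      rw [if_neg]
      rintro rfl
      exact hj rfl
    · simp
  · refine Finset.sum_eq_zero fun j _ => if_neg ?_
    have := j.2
    omega

lemma degree_toPoly_lt {m : ℕ} (a : Fin m → ZMod 2) : (toPoly a).degree < m := by
  rw [Polynomial.degree_lt_iff_coeff_zero]
  intro i hi
  rw [coeff_toPoly, dif_neg (by omega)]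

lemma readReg_wire {m : ℕ} (hm : 0 < m) (a b c : Fin m → ZMod 2) (x : Fin 3) :
    readReg (wire hm x) m (ket a b c) = toPoly (![a, b, c] x) := by
  ext i
  rw [coeff_readReg, coeff_toPoly]
  split_ifs with h
  · rw [ket_wire hm a b c x h]
  · rfl

/-- The upper half of a product is the lower half of the product of the reversed polynomials. -/
lemma coeff_mul_of_reversed {m q : ℕ} {A B A' B' : (ZMod 2)[X]} (hA : A.degree < m)
    (hB : B.degree < m) (hA' : ∀ i < m - 1, A'.coeff i = A.coeff (m - 1 - i))
    (hB' : ∀ i < m - 1, B'.coeff i = B.coeff (m - 1 - i)) (hq : q < m - 1) :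
    (A' * B').coeff q = (A * B).coeff (2 * m - 2 - q) := by
  have hdeg : ∀ p : (ZMod 2)[X], p.degree < m → p.natDegree ≤ m - 1 := by
    intro p hp
    rw [Polynomial.natDegree_le_iff_coeff_eq_zero]
    intro i hi
    exact (Polynomial.degree_lt_iff_coeff_zero p m).1 hp i (by omega)
  have key : (A * B).coeff (2 * m - 2 - q) = (reflect (m - 1) A * reflect (m - 1) B).coeff q := by
    rw [← Polynomial.reflect_mul A B (hdeg A hA) (hdeg B hB), Polynomial.coeff_reflect,
      Polynomial.revAt_le (by omega)]
    congr 1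
    omega
  rw [key, Polynomial.coeff_mul, Polynomial.coeff_mul]
  refine Finset.sum_congr rfl fun x hx => ?_
  have : x.1 + x.2 = q := by simpa using hx
  rw [Polynomial.coeff_reflect, Polynomial.coeff_reflect, Polynomial.revAt_le (by omega),
    Polynomial.revAt_le (by omega), hA' _ (by omega), hB' _ (by omega)]

/-- A multiplier for `X ^ m + Q`, where `Q` has low degree and `(1 + X) * Q` is sparse. -/
theorem exists_multiplier {m W t : ℕ} (hm : 2 ≤ m) {Q : (ZMod 2)[X]} (hQ0 : Q.coeff 0 = 1)
    (hQ : Q.natDegree ≤ m / 2) (hW : ((1 + X) * Q).support.card ≤ W) (ht : m ≤ 2 ^ t) :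
    ∃ c : Circuit (Wire m), ComputesMul (X ^ m + Q) c ∧
      c.gateCount ≤ 26 * 3 ^ t + 2 * (m * (W + 2)) := by
  have hm0 : 0 < m := by omega
  obtain ⟨k, l, hkl, hlk, hk2, hl0⟩ : ∃ k l, m = k + l ∧ l ≤ k ∧ l = m / 2 ∧ 0 < l :=
    ⟨(m + 1) / 2, m / 2, by omega, by omega, rfl, by omega⟩
  have hd : Distinct (wire hm0 2) m := fun i hi j hj e => wire_inj hm0 hi hj e
  have regs : ∀ (p q r : ℕ → ℕ) (n : ℕ), (∀ i < n, p i < m) → (∀ i < n, q i < m) →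
      (∀ i < n, r i < m) → (∀ i < n, ∀ j < n, p i = p j → i = j) →
      (∀ i < n, ∀ j < n, q i = q j → i = j) → (∀ i < n, ∀ j < n, r i = r j → i = j) →
      MulRegs (fun i => wire hm0 0 (p i)) (fun i => wire hm0 1 (q i))
        (fun i => wire hm0 2 (r i)) n n := by
    intro p q r n hp hq hr hp' hq' hr'
    exact ⟨fun i hi j hj e => hp' i hi j hj (wire_inj hm0 (hp i hi) (hp j hj) e),
      fun i hi j hj e => hq' i hi j hj (wire_inj hm0 (hq i hi) (hq j hj) e),
      fun i hi j hj e => hr' i hi j hj (wire_inj hm0 (hr i hi) (hr j hj) e),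
      fun i _ j _ => wire_ne hm0 (by decide) _ _, fun i _ j _ => wire_ne hm0 (by decide) _ _,
      fun i _ j _ => wire_ne hm0 (by decide) _ _⟩
  -- Degrees m to 2m - 2 of ab are m - 1 coefficients, and a₀, b₀ do not enter them. Coefficient q
  -- of the reversed product is coefficient 2m - 2 - q of ab; it goes to wire m - 2 - q, so that
  -- wire i receives coefficient m + i.
  have hhigh := implements_mulAdd_short t (m - 1) (by omega) _ _ _
    (regs (fun i => m - 1 - i) (fun i => m - 1 - i) (fun i => m - 2 - i) (m - 1)
      (by intros; omega) (by intros; omega) (by intros; omega) (by intros; omega)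
      (by intros; omega) (by intros; omega))
  have hlowp := implements_mulAdd_short t m ht _ _ _
    (regs (fun i => i) (fun i => i) (fun i => i) m
      (by intros; omega) (by intros; omega) (by intros; omega) (by intros; omega)
      (by intros; omega) (by intros; omega))
  -- The third register rotated, as it is to be read between the two multiplications by X^k and X^l.
  set r1 : ℕ → Wire m := fun i => if i < k then wire hm0 2 (l + i) else wire hm0 2 (i - k) with hr1
  have hd1 : Distinct r1 (k + l) := by
    intro i hi j hj e
    simp only [hr1] at e
    split_ifs at e <;> have := wire_inj hm0 (by omega) (by omega) e <;> omega
  have hr1mem : ∀ i, ∃ j, r1 i = wire hm0 2 j := by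
    intro i
    simp only [hr1]
    split_ifs <;> exact ⟨_, rfl⟩
  obtain ⟨F1, hF1, hF1r, hF1o⟩ := implements_mul_X_pow (r := wire hm0 2) (r' := r1) (j := k) (l := l)
    hd1 (by intro i hi; simp [hr1, hi]) (by intro i hi; simp [hr1]) hQ0 (by omega) (by omega) hW
  obtain ⟨F2, hF2, hF2r, hF2o⟩ := implements_mul_X_pow (r := r1) (r' := wire hm0 2) (j := l) (l := k)
    (by rw [add_comm, ← hkl]; exact hd) (by intro i hi; simp [hr1])
    (by intro i hi; simp [hr1, hi]) hQ0 (by omega) (by omega) hW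
  rw [add_comm l k] at hF2 hF2r hF2o
  rw [← hkl] at hF1 hF1r hF1o hF2 hF2r hF2o
  obtain ⟨c, hc, hrun⟩ := hlowp.comp (hF2.comp (hF1.comp hhigh))
  refine ⟨c, fun a b => ?_, hc.trans (by omega)⟩
  rw [hrun]
  set s0 := ket a b 0 with hs0
  have hlt : Q.degree < m := by
    refine Polynomial.degree_le_natDegree.trans_lt ?_
    exact_mod_cast (by omega : Q.natDegree < m)
  have hP : (X ^ m + Q).Monic := Polynomial.monic_X_pow_add hlt
  have hPd : (X ^ m + Q).degree = (m : WithBot ℕ) := degree_X_pow_add hlt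
  have hA := degree_toPoly_lt a
  have hB := degree_toPoly_lt b
  set s1 := mulAdd (fun i => wire hm0 0 (m - 1 - i)) (fun i => wire hm0 1 (m - 1 - i))
    (fun i => wire hm0 2 (m - 2 - i)) (m - 1) (m - 1) s0 with hs1
  have h1 : ∀ i, (readReg (wire hm0 2) m s1).coeff i = (toPoly a * toPoly b).coeff (m + i) := by
    intro i
    have hAB : (toPoly a * toPoly b).degree < ((2 * m - 1 : ℕ) : WithBot ℕ) :=
      degree_mul_lt_of_lt hA hB (by omega)
    have hz : ∀ i < m, s0 (wire hm0 2 i) = 0 := by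
      intro i hi
      rw [hs0, ket_wire hm0 a b 0 2 hi]
      rfl
    rw [coeff_readReg]
    rcases Nat.lt_or_ge i (m - 1) with hi | hi
    · rw [if_pos (by omega), hs1, mulAdd, Pi.add_apply, hz i (by omega), zero_add]
      have hi' : wire hm0 2 i = (fun i => wire hm0 2 (m - 2 - i)) (m - 2 - i) := by
        simp only
        congr 1
        omega
      rw [hi', writeReg_apply (regs (fun i => i) (fun i => i) (fun i => m - 2 - i) (m - 1)
          (by intros; omega) (by intros; omega) (by intros; omega) (by intros; omega)
          (by intros; omega) (by intros; omega)).out _ (by omega),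
        coeff_mul_of_reversed hA hB _ _ (by omega)]
      · congr 1
        omega
      · intro p hp
        rw [coeff_readReg, if_pos hp, hs0, ket_wire hm0 a b 0 0 (by omega), coeff_toPoly,
          dif_pos (by omega)]
        rfl
      · intro p hp
        rw [coeff_readReg, if_pos hp, hs0, ket_wire hm0 a b 0 1 (by omega), coeff_toPoly,
          dif_pos (by omega)]
        rfl
    · rw [Polynomial.coeff_eq_zero_of_degree_lt (hAB.trans_le (by exact_mod_cast (by omega)))]
      split_ifs with him
      · rw [hs1, mulAdd, Pi.add_apply, hz i him, zero_add, writeReg_apply_of_ne]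
        intro p hp e
        have := wire_inj hm0 (by omega) him e
        omega
      · rfl
  have h2 : readReg (wire hm0 2) m (F2 (F1 s1)) =
      (X ^ m * readReg (wire hm0 2) m s1) %ₘ (X ^ m + Q) := by
    rw [hF2r, hF1r]
    apply Polynomial.modByMonic_eq_of_dvd_sub hP
    have hdvd := Polynomial.modByMonic_add_div (X ^ k * readReg (wire hm0 2) m s1) (X ^ m + Q)
    refine ⟨- X ^ l * ((X ^ k * readReg (wire hm0 2) m s1) /ₘ (X ^ m + Q)), ?_⟩
    have hx : (X : (ZMod 2)[X]) ^ m = X ^ k * X ^ l := by rw [hkl, pow_add]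
    linear_combination X ^ l * hdvd - readReg (wire hm0 2) m s1 * hx
  have off : ∀ x : Fin 3, x ≠ 2 → ∀ i < m, F2 (F1 s1) (wire hm0 x i) = s0 (wire hm0 x i) := by
    intro x hx i _
    rw [hF2o _ _ fun j _ => wire_ne hm0 hx.symm _ _, hF1o, hs1, mulAdd, Pi.add_apply,
      writeReg_apply_of_ne _ fun j _ => wire_ne hm0 hx.symm _ _, add_zero]
    intro j _
    obtain ⟨p, hp⟩ := hr1mem j
    rw [hp]
    exact wire_ne hm0 hx.symm _ _
  have ra : readReg (wire hm0 0) m (F2 (F1 s1)) = toPoly a := by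
    rw [readReg_congr (t := s0) _ fun i hi => off 0 (by decide) i hi, hs0, readReg_wire]
    rfl
  have rb : readReg (wire hm0 1) m (F2 (F1 s1)) = toPoly b := by
    rw [readReg_congr (t := s0) _ fun i hi => off 1 (by decide) i hi, hs0, readReg_wire]
    rfl
  have hmod : ∀ i < m, ((toPoly a * toPoly b) %ₘ (X ^ m + Q)).coeff i =
      (readReg (wire hm0 2) m (F2 (F1 s1))).coeff i + (toPoly a * toPoly b).coeff i := by
    intro i hi
    have hsplit : toPoly a * toPoly b = X ^ m * readReg (wire hm0 2) m s1 +
        (toPoly a * toPoly b - X ^ m * readReg (wire hm0 2) m s1) := by ring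
    have hlow : (toPoly a * toPoly b - X ^ m * readReg (wire hm0 2) m s1).degree <
        (X ^ m + Q).degree := by
      rw [hPd, Polynomial.degree_lt_iff_coeff_zero]
      intro p hp
      obtain ⟨d, rfl⟩ := Nat.exists_eq_add_of_le hp
      rw [Polynomial.coeff_sub, Polynomial.coeff_X_pow_mul', if_pos hp, h1]
      simp
    conv_lhs => rw [hsplit]
    rw [Polynomial.add_modByMonic, (Polynomial.modByMonic_eq_self_iff hP).2 hlow, ← h2,
      Polynomial.coeff_add, Polynomial.coeff_sub, Polynomial.coeff_X_pow_mul', if_neg (by omega),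
      sub_zero]
  ext ⟨x, i⟩
  have hxi : ((x, i) : Wire m) = wire hm0 x i := by
    simp [wire, Nat.mod_eq_of_lt i.2]
  rw [hxi, ket_wire hm0 _ _ _ x i.2]
  change mulAdd (wire hm0 0) (wire hm0 1) (wire hm0 2) m m (F2 (F1 s1)) (wire hm0 x i) = _
  rw [mulAdd, ra, rb, Pi.add_apply]
  by_cases hx : x = 2
  · subst hx
    rw [writeReg_apply hd _ i.2]
    refine Eq.trans ?_ (hmod i i.2).symm
    rw [coeff_readReg, if_pos i.2]
  · rw [writeReg_apply_of_ne _ fun j _ => wire_ne hm0 (Ne.symm hx) _ _, add_zero, off x hx i i.2,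
      hs0, ket_wire hm0 _ _ _ x i.2]
    fin_cases x
    · rfl
    · rfl
    · exact absurd rfl hx

end Multiplier

/-! ### Sparsity of suitable polynomials and the asymptotic bound -/

section SuitablePolynomials

lemma card_support_one_add_X_mul_le (Q : (ZMod 2)[X]) :
    ((1 + X) * Q).support.card ≤ 2 * Q.support.card := by
  rw [add_mul, one_mul, two_mul]
  refine (Finset.card_le_card Polynomial.support_add).trans ((Finset.card_union_le _ _).trans ?_)
  have h : (X * Q).support.card ≤ (X : (ZMod 2)[X]).support.card * Q.support.card :=
    Polynomial.card_support_mul_le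
  have h1 : (X : (ZMod 2)[X]).support.card = 1 := by simp [Polynomial.support_X]
  rw [h1, one_mul] at h
  omega

/-- The bound on the number of terms of `(1 + X) * Q` for suitable polynomials `X ^ m + Q`. -/
lemma sparsePoly_spec {m : ℕ} {L : Finset ℕ} (hL : ∀ l ∈ L, 0 < l ∧ l < m / 2) :
    ∃ Q : (ZMod 2)[X], sparsePoly m L = X ^ m + Q ∧ Q.coeff 0 = 1 ∧ Q.natDegree ≤ m / 2 ∧
      ((1 + X) * Q).support.card ≤ 2 * (L.card + 1) := by
  have hc : ∀ i, (∑ l ∈ L, X ^ l + 1 : (ZMod 2)[X]).coeff i =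
      (if i ∈ L then 1 else 0) + (if i = 0 then 1 else 0) := by
    intro i
    simp [Polynomial.finsetSum_coeff, Polynomial.coeff_X_pow, Polynomial.coeff_one]
  refine ⟨∑ l ∈ L, X ^ l + 1, by rw [sparsePoly, add_assoc], ?_, ?_, ?_⟩
  · rw [hc, if_neg fun h => (hL 0 h).1.ne rfl]
    simp
  · rw [Polynomial.natDegree_le_iff_coeff_eq_zero]
    intro i hi
    rw [hc, if_neg fun h => by have := (hL i h).2; omega, if_neg (by omega), add_zero]
  · refine (card_support_one_add_X_mul_le _).trans (Nat.mul_le_mul_left 2 ?_)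
    refine (Finset.card_le_card (t := insert 0 L) ?_).trans (Finset.card_insert_le _ _)
    intro i hi
    rw [Polynomial.mem_support_iff, hc] at hi
    by_contra h
    rw [Finset.mem_insert, not_or] at h
    exact hi (by rw [if_neg h.2, if_neg h.1, add_zero])

/-- The factor 1 + X telescopes each run of consecutive monomials to its two ends. This is why
sparsity is measured on (1 + X)Q: Q itself may have about m/2 terms. -/
lemma runsPoly_spec {n l₁ l₂ : ℕ} (hl : l₁ + l₂ < n) :
    ∃ Q : (ZMod 2)[X], runsPoly n l₁ l₂ = X ^ (2 * n + 1) + Q ∧ Q.coeff 0 = 1 ∧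
      Q.natDegree ≤ n ∧ ((1 + X) * Q).support.card ≤ 4 := by
  have hc : ∀ i, (∑ i ∈ Finset.Ico (n - l₁) n, X ^ i + ∑ i ∈ Finset.range (l₂ + 1), X ^ i :
      (ZMod 2)[X]).coeff i =
      (if n - l₁ ≤ i ∧ i < n then 1 else 0) + (if i < l₂ + 1 then 1 else 0) := by
    intro i
    rw [Polynomial.coeff_add, Polynomial.finsetSum_coeff, Polynomial.finsetSum_coeff]
    simp only [Polynomial.coeff_X_pow, Finset.sum_ite_eq, Finset.mem_Ico, Finset.mem_range]
  refine ⟨∑ i ∈ Finset.Ico (n - l₁) n, X ^ i + ∑ i ∈ Finset.range (l₂ + 1), X ^ i,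
    by rw [runsPoly, add_assoc], ?_, ?_, ?_⟩
  · rw [hc, if_neg (by omega), if_pos (by omega), zero_add]
  · rw [Polynomial.natDegree_le_iff_coeff_eq_zero]
    intro i hi
    rw [hc, if_neg (by omega), if_neg (by omega), add_zero]
  · have e : (1 + X) * (∑ i ∈ Finset.Ico (n - l₁) n, X ^ i +
        ∑ i ∈ Finset.range (l₂ + 1), X ^ i : (ZMod 2)[X]) =
        X ^ n + X ^ (n - l₁) + X ^ (l₂ + 1) + 1 := by
      have h1 := geom_sum_Ico_mul (X : (ZMod 2)[X]) (show n - l₁ ≤ n by omega)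
      have h2 := geom_sum_mul (X : (ZMod 2)[X]) (l₂ + 1)
      linear_combination h1 + h2 + (∑ i ∈ Finset.Ico (n - l₁) n, X ^ i +
        ∑ i ∈ Finset.range (l₂ + 1), X ^ i - X ^ (n - l₁) - 1) * two_eq_zero_poly
    rw [e]
    refine (Finset.card_le_card (t := {n, n - l₁, l₂ + 1, 0}) ?_).trans Finset.card_le_four
    intro i hi
    rw [Polynomial.mem_support_iff] at hi
    by_contra h
    simp only [Finset.mem_insert, Finset.mem_singleton, not_or] at h
    exact hi (by simp [Polynomial.coeff_X_pow, Polynomial.coeff_one, h])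

/-- One logarithmic bound serves all four shapes. Only `lowDegree` needs the logarithm, its
exponents lying in [1, K log₂ m]; a cluster has at most K + 1 exponents. -/
lemma Suitable.exists_sparse {K m : ℕ} {P : (ZMod 2)[X]} (h : Suitable K m P) :
    ∃ Q : (ZMod 2)[X], P = X ^ m + Q ∧ 2 ≤ m ∧ Q.coeff 0 = 1 ∧ Q.natDegree ≤ m / 2 ∧
      (((1 + X) * Q).support.card : ℝ) ≤ (2 * K + 4) * (Real.logb 2 m + 1) := by
  have hlog : ∀ m : ℕ, 2 ≤ m → 0 ≤ Real.logb 2 m := fun m hm =>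
    Real.logb_nonneg (by norm_num) (by exact_mod_cast (by omega : 1 ≤ m))
  have hbound : ∀ m W : ℕ, 2 ≤ m → W ≤ 2 * K + 4 →
      (W : ℝ) ≤ (2 * K + 4) * (Real.logb 2 m + 1) := by
    intro m W hm hW
    have h1 : (W : ℝ) ≤ 2 * K + 4 := by exact_mod_cast hW
    have h2 : (0 : ℝ) ≤ 2 * K + 4 := by positivity
    nlinarith [hlog m hm]
  cases h with
  | trinomial l h0 hl =>
    obtain ⟨Q, h1, h2, h3, h4⟩ := sparsePoly_spec (m := m) (L := {l})
      (by simp only [Finset.mem_singleton]; rintro _ rfl; exact ⟨h0, hl⟩)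
    rw [Finset.card_singleton] at h4
    exact ⟨Q, h1, by omega, h2, h3, hbound m _ (by omega) (by omega)⟩
  | clustered hm L hne hL hK =>
    obtain ⟨Q, h1, h2, h3, h4⟩ := sparsePoly_spec hL
    have hm2 : 2 ≤ m := by
      obtain ⟨l, hl⟩ := hne
      have := hL l hl
      omega
    have hcard : L.card ≤ K + 1 := by
      have hsub : L ⊆ Finset.Icc (L.min' hne) (L.min' hne + K) := fun l hl =>
        Finset.mem_Icc.2 ⟨Finset.min'_le L l hl, hK l hl _ (L.min'_mem hne)⟩
      refine (Finset.card_le_card hsub).trans ?_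
      rw [Nat.card_Icc]
      omega
    exact ⟨Q, h1, hm2, h2, h3, hbound m _ hm2 (by omega)⟩
  | lowDegree L hne hL hK =>
    obtain ⟨Q, h1, h2, h3, h4⟩ := sparsePoly_spec hL
    have hm2 : 2 ≤ m := by
      obtain ⟨l, hl⟩ := hne
      have := hL l hl
      omega
    refine ⟨Q, h1, hm2, h2, h3, ?_⟩
    have hK0 : 0 ≤ K * Real.logb 2 m := mul_nonneg (Nat.cast_nonneg K) (hlog m hm2)
    have hsub : L ⊆ Finset.Icc 1 ⌊K * Real.logb 2 m⌋₊ := fun l hl =>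
      Finset.mem_Icc.2 ⟨(hL l hl).1, Nat.le_floor (hK l hl)⟩
    have hcard : L.card ≤ ⌊K * Real.logb 2 m⌋₊ := by
      simpa using Finset.card_le_card hsub
    have hcard' : (L.card : ℝ) ≤ K * Real.logb 2 m :=
      le_trans (by exact_mod_cast hcard) (Nat.floor_le hK0)
    have h4' : (((1 + X) * Q).support.card : ℝ) ≤ 2 * (L.card + 1) := by exact_mod_cast h4
    nlinarith [hlog m hm2, (Nat.cast_nonneg K : (0 : ℝ) ≤ K)]
  | runs n l₁ l₂ hm hl =>
    subst hm
    obtain ⟨Q, h1, h2, h3, h4⟩ := runsPoly_spec hl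
    exact ⟨Q, h1, by omega, h2, by omega, hbound _ _ (by omega) (by omega)⟩

/-- Rounding m up to a power of two at most doubles it, which costs a factor 3. -/
lemma three_pow_clog_le {m : ℕ} (hm : 2 ≤ m) :
    (3 : ℝ) ^ Nat.clog 2 m ≤ 3 * (m : ℝ) ^ Real.logb 2 3 := by
  have h2 : (2 : ℝ) ^ Real.logb 2 3 = 3 := Real.rpow_logb (by norm_num) (by norm_num) (by norm_num)
  have hlt : 2 ^ (Nat.clog 2 m - 1) < m := Nat.pow_pred_clog_lt_self (by norm_num) (by omega)
  have hpos : 0 < Nat.clog 2 m := Nat.clog_pos (by norm_num) hm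
  obtain ⟨t, ht⟩ : ∃ t, Nat.clog 2 m = t + 1 := ⟨Nat.clog 2 m - 1, by omega⟩
  rw [ht] at hlt ⊢
  rw [Nat.add_sub_cancel] at hlt
  have hlt' : (2 : ℝ) ^ t ≤ m := by exact_mod_cast hlt.le
  rw [pow_succ, mul_comm]
  gcongr
  calc (3 : ℝ) ^ t = ((2 : ℝ) ^ Real.logb 2 3) ^ t := by rw [h2]
    _ = ((2 : ℝ) ^ t) ^ Real.logb 2 3 := by
      rw [← Real.rpow_natCast, ← Real.rpow_natCast, ← Real.rpow_mul (by norm_num),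
        ← Real.rpow_mul (by norm_num), mul_comm]
    _ ≤ (m : ℝ) ^ Real.logb 2 3 :=
      Real.rpow_le_rpow (by positivity) hlt' (Real.logb_nonneg (by norm_num) (by norm_num))

/-- Equivalent to 8 ≤ 9. It leaves room for a factor √m over linear cost, enough to absorb log m. -/
lemma three_halves_le_logb : (3 / 2 : ℝ) ≤ Real.logb 2 3 := by
  rw [Real.le_logb_iff_rpow_le (by norm_num) (by norm_num)]
  refine le_of_sq_le_sq ?_ (by norm_num)
  rw [← Real.rpow_natCast, ← Real.rpow_mul (by norm_num)]
  norm_num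

lemma logb_add_one_le_sqrt {m : ℕ} (hm : 1 ≤ m) :
    Real.logb 2 m + 1 ≤ 5 * (m : ℝ) ^ (1 / 2 : ℝ) := by
  have hm' : (1 : ℝ) ≤ m := by exact_mod_cast hm
  have h1 : (1 : ℝ) ≤ (m : ℝ) ^ (1 / 2 : ℝ) := Real.one_le_rpow hm' (by norm_num)
  have h2 := Real.log_le_rpow_div (x := m) (by positivity) (show (0 : ℝ) < 1 / 2 by norm_num)
  have h3 : (1 / 2 : ℝ) ≤ Real.log 2 := by linarith [Real.log_two_gt_d9]
  have h4 : Real.logb 2 m ≤ 4 * (m : ℝ) ^ (1 / 2 : ℝ) := by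
    rw [Real.logb, div_le_iff₀ (by linarith)]
    nlinarith
  linarith

/-- Suitable polynomials have multipliers with `O(m ^ log₂ 3)` gates. -/
theorem exists_multiplier_of_suitable (K : ℕ) : ∃ C : ℝ, ∀ (m : ℕ) (P : (ZMod 2)[X]),
    Suitable K m P → ∃ c : Circuit (Wire m), ComputesMul P c ∧
      (c.gateCount : ℝ) ≤ C * (m : ℝ) ^ Real.logb 2 3 := by
  -- 78 = 26 * 3 comes from the two products after rounding m up to a power of two. The rest comes
  -- from the two modular shifts, with log₂ m + 1 ≤ 5√m.
  refine ⟨78 + 2 * (5 * (2 * K + 4) + 2), fun m P h => ?_⟩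
  obtain ⟨Q, rfl, hm, hQ0, hQ, hW⟩ := h.exists_sparse
  obtain ⟨c, hc, hcount⟩ := exists_multiplier hm hQ0 hQ le_rfl (Nat.le_pow_clog (by norm_num) m)
  refine ⟨c, hc, ?_⟩
  have hcount' : (c.gateCount : ℝ) ≤
      26 * 3 ^ Nat.clog 2 m + 2 * (m * (((1 + X) * Q).support.card + 2)) := by
    exact_mod_cast hcount
  have hm' : (1 : ℝ) ≤ m := by exact_mod_cast (by omega : 1 ≤ m)
  have h1 := three_pow_clog_le hm
  have h2 := logb_add_one_le_sqrt (show 1 ≤ m by omega)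
  have h3 : (1 : ℝ) ≤ (m : ℝ) ^ (1 / 2 : ℝ) := Real.one_le_rpow hm' (by norm_num)
  have h4 : (m : ℝ) * (m : ℝ) ^ (1 / 2 : ℝ) ≤ (m : ℝ) ^ Real.logb 2 3 := by
    calc (m : ℝ) * (m : ℝ) ^ (1 / 2 : ℝ) = (m : ℝ) ^ (3 / 2 : ℝ) := by
          rw [show (3 / 2 : ℝ) = 1 + 1 / 2 by norm_num, Real.rpow_add (by linarith), Real.rpow_one]
      _ ≤ _ := Real.rpow_le_rpow_of_exponent_le hm' three_halves_le_logb
  have hK : (0 : ℝ) ≤ 2 * K + 4 := by positivity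
  have h5 : (((1 + X) * Q).support.card : ℝ) + 2 ≤
      (5 * (2 * K + 4) + 2) * (m : ℝ) ^ (1 / 2 : ℝ) := by
    have := mul_le_mul_of_nonneg_left h2 hK
    linarith
  have h6 : (m : ℝ) * (((1 + X) * Q).support.card + 2) ≤
      (5 * (2 * K + 4) + 2) * (m : ℝ) ^ Real.logb 2 3 := by
    calc (m : ℝ) * (((1 + X) * Q).support.card + 2)
        ≤ m * ((5 * (2 * K + 4) + 2) * (m : ℝ) ^ (1 / 2 : ℝ)) := by gcongr
      _ = (5 * (2 * K + 4) + 2) * (m * (m : ℝ) ^ (1 / 2 : ℝ)) := by ring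
      _ ≤ _ := by gcongr
  linarith

end SuitablePolynomials

/-! ### Schoolbook multipliers and irreducible polynomials of every degree -/

section SmallDegrees

/-- No target is ever a control, so every gate reads the original bits. -/
lemma implements_add_products {ι κ : Type} [DecidableEq ι] (J : Finset κ) (a b t : κ → ι)
    (hab : ∀ j, a j ≠ b j) (ha : ∀ i j, a i ≠ t j) (hb : ∀ i j, b i ≠ t j) :
    Implements J.card (fun s => s + ∑ j ∈ J, Pi.single (t j) (s (a j) * s (b j))) := by
  classical
  induction J using Finset.induction_on with
  | empty => exact Implements.id.congr (by simp)
  | insert j J hj ih =>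
    rw [Finset.card_insert_of_notMem hj]
    refine ((implements_toffoli (hab j) (ha j j) (hb j j)).comp ih).congr fun s => ?_
    have hz : ∀ w, (∀ i, w ≠ t i) →
        (∑ i ∈ J, Pi.single (t i) (s (a i) * s (b i)) : ι → ZMod 2) w = 0 := by
      intro w hw
      rw [Finset.sum_apply]
      exact Finset.sum_eq_zero fun i _ => Pi.single_eq_of_ne (hw i) _
    rw [Finset.sum_insert hj, Pi.add_apply, Pi.add_apply, hz _ (ha j), hz _ (hb j)]
    simp only [add_zero]
    abel

/-- Schoolbook multiplication. -/
theorem exists_computesMul {m : ℕ} (P : (ZMod 2)[X]) :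
    ∃ c : Circuit (Wire m), ComputesMul P c := by
  obtain ⟨c, -, hc⟩ := implements_add_products (ι := Wire m)
    -- One Toffoli gate for each triple (i, j, l) such that x^l occurs in x^(i+j) reduced modulo P.
    (Finset.univ.filter fun x : (Fin m × Fin m) × Fin m =>
      ((X ^ (x.1.1 + x.1.2 : ℕ) : (ZMod 2)[X]) %ₘ P).coeff x.2 = 1)
    (fun x => (0, x.1.1)) (fun x => (1, x.1.2)) (fun x => (2, x.2)) (by simp) (by simp) (by simp)
  refine ⟨c, fun a b => ?_⟩
  have hbit : ∀ x y : ZMod 2, (if x = 1 then y else 0) = y * x := by decide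
  have hprod : toPoly a * toPoly b =
      ∑ i : Fin m, ∑ j : Fin m, (a i * b j) • (X : (ZMod 2)[X]) ^ (i + j : ℕ) := by
    rw [toPoly, toPoly, Finset.sum_mul_sum]
    refine Finset.sum_congr rfl fun i _ => Finset.sum_congr rfl fun j _ => ?_
    rw [Polynomial.smul_eq_C_mul, map_mul, pow_add]
    ring
  have hmod : (toPoly a * toPoly b) %ₘ P =
      ∑ i : Fin m, ∑ j : Fin m, (a i * b j) • ((X : (ZMod 2)[X]) ^ (i + j : ℕ) %ₘ P) := by
    rw [hprod]
    change Polynomial.modByMonicHom P _ = _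
    simp only [map_sum, map_smul]
    rfl
  rw [hc]
  simp only [Finset.sum_filter, Fintype.sum_prod_type]
  ext ⟨x, k⟩
  simp only [Pi.add_apply, Finset.sum_apply]
  fin_cases x
  · have : ∀ (i j l : Fin m) (y : ZMod 2), (if ((X ^ (i + j : ℕ) : (ZMod 2)[X]) %ₘ P).coeff l = 1
        then Pi.single ((2, l) : Wire m) y else 0 : Wire m → ZMod 2) (0, k) = 0 := by
      intro i j l y
      split_ifs <;> simp
    simp [ket, this]
  · have : ∀ (i j l : Fin m) (y : ZMod 2), (if ((X ^ (i + j : ℕ) : (ZMod 2)[X]) %ₘ P).coeff l = 1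
        then Pi.single ((2, l) : Wire m) y else 0 : Wire m → ZMod 2) (1, k) = 0 := by
      intro i j l y
      split_ifs <;> simp
    simp [ket, this]
  · have : ∀ (i j l : Fin m) (y : ZMod 2), (if ((X ^ (i + j : ℕ) : (ZMod 2)[X]) %ₘ P).coeff l = 1
        then Pi.single ((2, l) : Wire m) y else 0 : Wire m → ZMod 2) (2, k) =
        if k = l then y * ((X ^ (i + j : ℕ) : (ZMod 2)[X]) %ₘ P).coeff l else 0 := by
      intro i j l y
      rw [← hbit]
      by_cases hkl : k = l
      · subst hkl
        rw [if_pos (rfl : k = k)]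
        split_ifs <;> simp
      · split_ifs <;> simp [hkl]
    simp [ket, fieldMul, hmod, this, Polynomial.finsetSum_coeff]

/-- The minimal polynomial of a primitive element of GF(2^m) over 𝔽₂. -/
lemma exists_irreducible_natDegree (m : ℕ) (hm : 1 ≤ m) :
    ∃ P : (ZMod 2)[X], Irreducible P ∧ P.natDegree = m := by
  obtain ⟨x, hx⟩ := Field.exists_primitive_element (ZMod 2) (GaloisField 2 m)
  have hint : IsIntegral (ZMod 2) x := Algebra.IsIntegral.isIntegral x
  refine ⟨minpoly (ZMod 2) x, minpoly.irreducible hint, ?_⟩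
  rw [← IntermediateField.adjoin.finrank hint, hx, IntermediateField.finrank_top',
    GaloisField.finrank 2 (by omega)]

lemma Suitable.natDegree_eq {K m : ℕ} {P : (ZMod 2)[X]} (h : Suitable K m P) :
    P.natDegree = m := by
  obtain ⟨Q, rfl, hm, -, hQ, -⟩ := h.exists_sparse
  refine Polynomial.natDegree_eq_of_degree_eq_some (degree_X_pow_add ?_)
  exact Polynomial.degree_le_natDegree.trans_lt (by exact_mod_cast (by omega : Q.natDegree < m))

end SmallDegrees

end GFMul

theorem mainTheorem5 :
    (∀ K : ℕ, ∃ C : ℝ, ∀ (m : ℕ) (P : Polynomial (ZMod 2)),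
      Irreducible P → GFMul.Suitable K m P →
      ∃ c : GFMul.Circuit (GFMul.Wire m), GFMul.ComputesMul P c ∧
        (c.gateCount : ℝ) ≤ C * (m : ℝ) ^ Real.logb 2 3) ∧
    ((∃ K : ℕ, ∀ᶠ m : ℕ in Filter.atTop, ∃ P : Polynomial (ZMod 2),
        Irreducible P ∧ GFMul.Suitable K m P) →
      ∃ C : ℝ, ∀ m : ℕ, 1 ≤ m → ∃ P : Polynomial (ZMod 2),
        Irreducible P ∧ P.natDegree = m ∧
        ∃ c : GFMul.Circuit (GFMul.Wire m), GFMul.ComputesMul P c ∧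
          (c.gateCount : ℝ) ≤ C * (m : ℝ) ^ Real.logb 2 3) := by
  refine ⟨fun K => ?_, ?_⟩
  · obtain ⟨C, hC⟩ := GFMul.exists_multiplier_of_suitable K
    exact ⟨C, fun m P _ h => hC m P h⟩
  · rintro ⟨K, hK⟩
    obtain ⟨M, hM⟩ := Filter.eventually_atTop.1 hK
    obtain ⟨C, hC⟩ := GFMul.exists_multiplier_of_suitable K
    have hsmall : ∀ m : ℕ, ∃ N : ℕ, 1 ≤ m → ∃ P : Polynomial (ZMod 2),
        Irreducible P ∧ P.natDegree = m ∧
        ∃ c : GFMul.Circuit (GFMul.Wire m), GFMul.ComputesMul P c ∧ c.gateCount = N := by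
      intro m
      by_cases hm : 1 ≤ m
      · obtain ⟨P, hP, hd⟩ := GFMul.exists_irreducible_natDegree m hm
        obtain ⟨c, hc⟩ := GFMul.exists_computesMul (m := m) P
        exact ⟨c.gateCount, fun _ => ⟨P, hP, hd, c, hc, rfl⟩⟩
      · exact ⟨0, fun h => absurd h hm⟩
    choose N hN using hsmall
    -- The sum dominates the gate count of each degree below M, and m^{log₂ 3} ≥ 1 makes the
    -- constant suffice there.
    refine ⟨max C (∑ m ∈ Finset.range M, N m : ℕ), fun m hm => ?_⟩
    have hpos : (1 : ℝ) ≤ (m : ℝ) ^ Real.logb 2 3 :=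
      Real.one_le_rpow (by exact_mod_cast hm) (Real.logb_nonneg (by norm_num) (by norm_num))
    rcases Nat.lt_or_ge m M with h | h
    · obtain ⟨P, hP, hd, c, hc, hcN⟩ := hN m hm
      refine ⟨P, hP, hd, c, hc, ?_⟩
      have h1 : N m ≤ ∑ m ∈ Finset.range M, N m :=
        Finset.single_le_sum (fun _ _ => Nat.zero_le _) (Finset.mem_range.2 h)
      have h2 : (c.gateCount : ℝ) ≤ max C (∑ m ∈ Finset.range M, N m : ℕ) :=
        le_max_of_le_right (by rw [hcN]; exact_mod_cast h1)
      exact h2.trans (le_mul_of_one_le_right ((Nat.cast_nonneg _).trans h2) hpos)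
    · obtain ⟨P, hP, hS⟩ := hM m h
      obtain ⟨c, hc, hcount⟩ := hC m P hS
      refine ⟨P, hP, hS.natDegree_eq, c, hc, hcount.trans ?_⟩
      gcongr
      exact le_max_left _ _
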